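/- Let $\mathbf{C}$ be the space of real continuous functions on $[0,1]$ vanishing at $0$, with the supremum norm, and let $\mathfrak{C}$ be its Borel $\sigma$-field. For $t_1,\dots,t_k\in[0,1]$ let $\pi_{t_1,\dots,t_k}:\mathbf{C}\to\mathbb{R}^k$, $\pi_{t_1,\dots,t_k}(x)=(x(t_1),\dots,x(t_k))$, let $\nu_{t_1,\dots,t_k}$ be the (possibly degenerate) $k$-variate normal distribution on $\mathbb{R}^k$ with zero means and covariances $\min\{t_j,t_r\}$, and let $\alpha_{t_1,\dots,t_k}$ be the measure that it induces through $\pi_{t_1,\dots,t_k}$ on the $\sigma$-field $\{\pi_{t_1,\dots,t_k}^{-1}(B): B\subset\mathbb{R}^k \text{ Borel}\}$, namely $\alpha_{t_1,\dots,t_k}(\pi_{t_1,\dots,t_k}^{-1}(B))=\nu_{t_1,\dots,t_k}\big(B\cap\pi_{t_1,\dots,t_k}(\mathbf{C})\big)$; this is $\nu_{t_1,\dots,t_k}(B)$ if the $t_j$ are distinct and positive. Let $t_1,t_2,\dots$ be a sequence that is dense in $[0,1]$. For compact $K\subset\mathbf{C}$ set $$\varphi(K)=\lim_{n\to\infty}\alpha_{t_1,\dots,t_n}\big(\pi_{t_1,\dots,t_n}^{-1}\,\pi_{t_1,\dots,t_n}(K)\big)$$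 (the sequence is non-increasing, so the limit exists), and for $A\in\mathfrak{C}$ set $$\mu(A)=\sup\{\varphi(K): K\subset A,\ K\text{ compact}\}.$$ (i) Let $A_n\in\mathfrak{C}$, $n\ge1$, be an increasing sequence whose union is a compact set $K$. Then the sequence $\mu(A_n)$ is non-decreasing and converges to $\mu(K)$. (ii) Let $A_n\in\mathfrak{C}$, $n\ge1$, be an increasing sequence whose union is $A\in\mathfrak{C}$. Then the sequence $\mu(A_n)$ is non-decreasing and converges to $\mu(A)$; that is, $\mu$ is continuous from below on $\mathfrak{C}$. -/

import Mathlib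

open Set Filter Topology MeasureTheory ProbabilityTheory
open scoped ENNReal unitInterval

noncomputable section

namespace Wiener

/-- The space of real continuous functions on `[0, 1]` that vanish at `0`, with the metric of the
supremum norm (inherited from `C([0, 1], ℝ)`). -/
abbrev C₀ : Type := {x : C(I, ℝ) // x 0 = 0}

/-- The projection `x ↦ (x(t₁), …, x(tₖ))`. -/
def proj {k : ℕ} (t : Fin k → I) (x : C₀) : EuclideanSpace ℝ (Fin k) :=
  WithLp.toLp 2 fun j => x.1 (t j)

/-- The matrix `(min {tⱼ, tᵣ})`. -/
def minCov {k : ℕ} (t : Fin k → I) : Matrix (Fin k) (Fin k) ℝ :=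
  Matrix.of fun j r => min (t j : ℝ) (t r : ℝ)

/-- The `k`-variate normal distribution with zero means and covariances `min {tⱼ, tᵣ}`. -/
def normal {k : ℕ} (t : Fin k → I) : Measure (EuclideanSpace ℝ (Fin k)) :=
  multivariateGaussian 0 (minCov t)

/-- The sub-σ-field of the events that are inverse images of Borel sets under the projection. -/
abbrev cylinders {k : ℕ} (t : Fin k → I) : MeasurableSpace C₀ :=
  MeasurableSpace.comap (proj t) inferInstance

theorem cylinders_le_caratheodory {k : ℕ} (t : Fin k → I) :
    cylinders t ≤ (OuterMeasure.comap (proj t) (normal t).toOuterMeasure).caratheodory := by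
  rintro _ ⟨B, hB, rfl⟩
  rw [OuterMeasure.isCaratheodory_iff]
  intro S
  simp only [OuterMeasure.comap_apply, Measure.coe_toOuterMeasure]
  rw [image_inter_preimage, ← measure_inter_add_sdiff (proj t '' S) hB, ← image_sdiff_preimage]

/-- The measure on the sub-σ-field of cylinder events that the normal distribution induces through
the projection: an event `A` has the measure of its image (see `cylMeasure_preimage`). -/
def cylMeasure {k : ℕ} (t : Fin k → I) : @Measure C₀ (cylinders t) :=
  @OuterMeasure.toMeasure C₀ (cylinders t)
    (OuterMeasure.comap (proj t) (normal t).toOuterMeasure) (cylinders_le_caratheodory t)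

theorem cylMeasure_preimage {k : ℕ} (t : Fin k → I) {B : Set (EuclideanSpace ℝ (Fin k))}
    (hB : MeasurableSet B) :
    @DFunLike.coe (@Measure C₀ (cylinders t)) (Set C₀) (fun _ => ℝ≥0∞) _ (cylMeasure t)
      (proj t ⁻¹' B) = normal t (B ∩ range (proj t)) := by
  have h := @toMeasure_apply C₀ (cylinders t) _ (cylinders_le_caratheodory t) (proj t ⁻¹' B)
    ⟨B, hB, rfl⟩
  rw [cylMeasure, h]
  simp [OuterMeasure.comap_apply, image_preimage_eq_inter_range]

/-- The first `n` members of a sequence of times. -/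
def firstTimes (t : ℕ → I) (n : ℕ) : Fin n → I := fun j => t j

/-- The probability `α_{t₁,…,tₙ}(π⁻¹ π K)`, where `π` is the projection at `t₁, …, tₙ`. -/
def approx (t : ℕ → I) (K : Set C₀) (n : ℕ) : ℝ≥0∞ :=
  @DFunLike.coe (@Measure C₀ (cylinders (firstTimes t n))) (Set C₀) (fun _ => ℝ≥0∞) _
    (cylMeasure (firstTimes t n)) (proj (firstTimes t n) ⁻¹' (proj (firstTimes t n) '' K))

/-- The set function on compact sets: the limit of `α_{t₁,…,tₙ}(π⁻¹ π K)` as `n → ∞`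
(the limit exists, see `tendsto_phi`). -/
def phi (t : ℕ → I) (K : Set C₀) : ℝ≥0∞ := limUnder atTop (approx t K)

/-- The set function on Borel sets: the supremum of `phi` over the compact subsets. -/
def mu (t : ℕ → I) (A : Set C₀) : ℝ≥0∞ := ⨆ (K : Set C₀) (_ : K ⊆ A) (_ : IsCompact K), phi t K

theorem continuous_proj {k : ℕ} (t : Fin k → I) : Continuous (proj t) := by
  unfold proj
  fun_prop

theorem posSemidef_minCov {k : ℕ} (t : Fin k → I) : (minCov t).PosSemidef := by
  classical
  let s : Fin k → NNReal := fun j => ⟨t j, (t j).2.1⟩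
  exact (BrownianReal.posSemidef_covMatrix (Finset.univ.image s)).submatrix
    (fun j => ⟨s j, Finset.mem_image_of_mem s (Finset.mem_univ j)⟩)

theorem approx_eq (t : ℕ → I) {K : Set C₀} (hK : IsCompact K) (n : ℕ) :
    approx t K n = normal (firstTimes t n) (proj (firstTimes t n) '' K) := by
  rw [approx, cylMeasure_preimage _ (hK.image (continuous_proj _)).measurableSet,
    inter_eq_left.2 (image_subset_range _ _)]

/-- Forgetting the last coordinate. -/
def forget (n : ℕ) (v : EuclideanSpace ℝ (Fin (n + 1))) : EuclideanSpace ℝ (Fin n) :=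
  WithLp.toLp 2 fun j => v j.castSucc

theorem map_forget (t : ℕ → I) (n : ℕ) :
    (normal (firstTimes t (n + 1))).map (forget n) = normal (firstTimes t n) := by
  have hm : Measurable (forget n) := by unfold forget; fun_prop
  have : IsProbabilityMeasure (normal (firstTimes t (n + 1))) := by unfold normal; infer_instance
  have : IsProbabilityMeasure (normal (firstTimes t n)) := by unfold normal; infer_instance
  refine Measure.ext_of_charFun (funext fun u => ?_)
  let w : EuclideanSpace ℝ (Fin (n + 1)) :=
    WithLp.toLp 2 (Fin.snoc (α := fun _ => ℝ) (fun j => u j) 0)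
  have h1 : charFun ((normal (firstTimes t (n + 1))).map (forget n)) u =
      charFun (normal (firstTimes t (n + 1))) w := by
    rw [charFun_apply, charFun_apply, integral_map hm.aemeasurable (by fun_prop)]
    congr! 5 with x
    simp [PiLp.inner_apply, Fin.sum_univ_castSucc, w, forget]
  rw [h1, normal, normal, charFun_multivariateGaussian (posSemidef_minCov _),
    charFun_multivariateGaussian (posSemidef_minCov _)]
  simp [dotProduct, Matrix.mulVec, Fin.sum_univ_castSucc, w, minCov, firstTimes]

theorem tendsto_phi (t : ℕ → I) {K : Set C₀} (hK : IsCompact K) :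
    Tendsto (approx t K) atTop (𝓝 (phi t K)) := by
  have h : Antitone (approx t K) := by
    refine antitone_nat_of_succ_le fun n => ?_
    have hm : Measurable (forget n) := by unfold forget; fun_prop
    rw [approx_eq t hK, approx_eq t hK, ← map_forget t n,
      Measure.map_apply hm (hK.image (continuous_proj _)).measurableSet]
    refine measure_mono ?_
    rintro _ ⟨x, hx, rfl⟩
    exact ⟨x, hx, rfl⟩
  exact tendsto_nhds_limUnder ⟨_, tendsto_atTop_iInf h⟩

end Wiener

end

open Set Filter Topology MeasureTheory ProbabilityTheory
open scoped ENNReal unitInterval RealInnerProductSpace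

section GramSchmidt

open InnerProductSpace

variable {E : Type*} [NormedAddCommGroup E] [InnerProductSpace ℝ E]

/-! On Borel sets `mu` is a finite measure, so continuity from below is automatic. The normal laws
along `t` are the marginals of one law `P` on real sequences, obtained by applying a triangular
factor of the covariances to i.i.d. standard normals (`exists_sequence_law`). By compactness and
continuity of `P` from above, `phi t K = P (sample t '' K)`. As `t` is dense, `sample t` is
injective, hence a measurable embedding of a Polish space, and inner regularity identifies `mu t`
with the pullback of `P`. That `P` charges the sampled paths is never needed. -/

theorem inner_gramSchmidtNormed_smul_self (v : ℕ → E) (m k : ℕ) :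
    ⟪gramSchmidtNormed ℝ v k, gramSchmidtNormed ℝ v m⟫ • gramSchmidtNormed ℝ v k =
      if k = m then gramSchmidtNormed ℝ v m else 0 := by
  split_ifs with h
  · subst h
    -- The vectors may be dependent (repeated or zero times); Gram–Schmidt then yields zero vectors.
    by_cases h0 : gramSchmidtNormed ℝ v k = 0
    · simp [h0]
    · rw [real_inner_self_eq_norm_sq, gramSchmidtNormed_unit_length' h0]
      simp
  · simp [gramSchmidtNormed, inner_smul_left, inner_smul_right, gramSchmidt_orthogonal ℝ v h]

theorem sum_inner_gramSchmidtNormed_smul (v : ℕ → E) {n j : ℕ} (hj : j < n) :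
    ∑ k ∈ Finset.range n, ⟪gramSchmidtNormed ℝ v k, v j⟫ • gramSchmidtNormed ℝ v k = v j := by
  -- The identity is linear in `w`, so it need only be checked on the orthonormalised vectors.
  suffices h : ∀ w ∈ Submodule.span ℝ (gramSchmidtNormed ℝ v '' Set.Iio n),
      ∑ k ∈ Finset.range n, ⟪gramSchmidtNormed ℝ v k, w⟫ • gramSchmidtNormed ℝ v k = w by
    refine h _ ?_
    rw [span_gramSchmidtNormed, span_gramSchmidt_Iio]
    exact Submodule.subset_span ⟨j, hj, rfl⟩
  intro w hmem
  induction hmem using Submodule.span_induction with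
  | mem x hx =>
    obtain ⟨m, hm, rfl⟩ := hx
    simp only [inner_gramSchmidtNormed_smul_self]
    rw [Finset.sum_ite_eq', if_pos (Finset.mem_range.2 hm)]
  | zero => simp
  | add x y _ _ hx hy =>
    simp only [inner_add_right, add_smul, Finset.sum_add_distrib, hx, hy]
  | smul a x _ hx =>
    simp only [inner_smul_right, mul_smul, ← Finset.smul_sum, hx]

theorem inner_gramSchmidtNormed_eq_zero (v : ℕ → E) {j k : ℕ} (h : j < k) :
    ⟪gramSchmidtNormed ℝ v k, v j⟫ = 0 := by
  simp [gramSchmidtNormed, inner_smul_left, gramSchmidt_inv_triangular ℝ v h]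

/-- A sequence of vectors has a lower triangular Cholesky factor of its Gram matrix. -/
theorem exists_triangular_gram (v : ℕ → E) :
    ∃ a : ℕ → ℕ → ℝ, (∀ j k, j < k → a j k = 0) ∧
      ∀ n i j, i < n → j < n → ∑ k ∈ Finset.range n, a i k * a j k = ⟪v i, v j⟫ := by
  refine ⟨fun j k => ⟪gramSchmidtNormed ℝ v k, v j⟫,
    fun j k h => inner_gramSchmidtNormed_eq_zero v h, fun n i j hi _ => ?_⟩
  conv_rhs => rw [← sum_inner_gramSchmidtNormed_smul v hi]
  simp [sum_inner, inner_smul_left]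

end GramSchmidt

namespace Wiener

/-- The indicators of `[0, s]` and `[0, t]` have inner product `min s t` in `L²`. -/
theorem exists_triangular_min (t : ℕ → I) :
    ∃ a : ℕ → ℕ → ℝ, (∀ j k, j < k → a j k = 0) ∧
      ∀ n i j, i < n → j < n →
        ∑ k ∈ Finset.range n, a i k * a j k = min (t i : ℝ) (t j : ℝ) := by
  obtain ⟨a, ha, h⟩ := exists_triangular_gram fun n =>
    indicatorConstLp (μ := (volume : Measure ℝ)) 2 (measurableSet_Icc (a := 0) (b := (t n : ℝ)))
      isCompact_Icc.measure_ne_top (1 : ℝ)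
  refine ⟨a, ha, fun n i j hi hj => ?_⟩
  rw [h n i j hi hj, L2.real_inner_indicatorConstLp_one_indicatorConstLp_one measurableSet_Icc
    measurableSet_Icc isCompact_Icc.measure_ne_top isCompact_Icc.measure_ne_top, Icc_inter_Icc]
  simp [(t i).2.1, (t j).2.1]

/-- The first `n` terms of a sequence, as a Euclidean vector. -/
def firstCoords (n : ℕ) (y : ℕ → ℝ) : EuclideanSpace ℝ (Fin n) := WithLp.toLp 2 fun j => y j

theorem continuous_firstCoords (n : ℕ) : Continuous (firstCoords n) := by
  unfold firstCoords
  fun_prop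

theorem measurable_const_mul_eval (r : ℝ) (k : ℕ) : Measurable fun z : ℕ → ℝ => r * z k := by
  fun_prop

/-- The argument `1` suffices: a test vector `u` is absorbed into the coefficients `c`. -/
theorem charFun_map_sum_mul_infinitePi_gaussianReal (c : ℕ → ℝ) (s : Finset ℕ) :
    charFun ((Measure.infinitePi fun _ : ℕ => gaussianReal 0 1).map
      fun z => ∑ k ∈ s, c k * z k) 1 = Complex.exp (-(∑ k ∈ s, c k ^ 2 : ℝ) / 2) := by
  have hind : iIndepFun (fun k (z : ℕ → ℝ) => c k * z k)
      (Measure.infinitePi fun _ : ℕ => gaussianReal 0 1) :=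
    iIndepFun_infinitePi (X := fun k x => c k * x) fun k => by fun_prop
  rw [(hind.restrict s).charFun_map_fun_finsetSum_eq_prod fun k _ =>
      (measurable_const_mul_eval (c k) k).aemeasurable,
    Finset.prod_apply, Complex.ofReal_sum, ← Finset.sum_neg_distrib, Finset.sum_div,
    Complex.exp_sum]
  refine Finset.prod_congr rfl fun k _ => ?_
  have hmap : (Measure.infinitePi fun _ : ℕ => gaussianReal 0 1).map (fun z => c k * z k) =
      (gaussianReal 0 1).map (c k * ·) := by
    have := Measure.map_map (μ := Measure.infinitePi fun _ : ℕ => gaussianReal 0 1)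
      (measurable_const_mul (c k)) (measurable_pi_apply k)
    rwa [Measure.infinitePi_map_eval, eq_comm] at this
  rw [hmap, gaussianReal_map_const_mul, charFun_gaussianReal]
  simp [neg_div]

/-- The normal distributions along a sequence of times extend to a measure on sequences. -/
theorem exists_sequence_law (t : ℕ → I) :
    ∃ P : Measure (ℕ → ℝ), IsProbabilityMeasure P ∧
      ∀ n, P.map (firstCoords n) = normal (firstTimes t n) := by
  obtain ⟨a, ha, h⟩ := exists_triangular_min t
  let X : (ℕ → ℝ) → ℕ → ℝ := fun z j => ∑ k ∈ Finset.range (j + 1), a j k * z k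
  have hX : Measurable X := by fun_prop
  refine ⟨(Measure.infinitePi fun _ : ℕ => gaussianReal 0 1).map X,
    Measure.isProbabilityMeasure_map hX.aemeasurable, fun n => ?_⟩
  have hf := (continuous_firstCoords n).measurable
  -- Triangularity lets one range of summation serve all coordinates below `n`.
  have hXn : ∀ z (j : Fin n), X z j = ∑ k ∈ Finset.range n, a j k * z k := fun z j =>
    Finset.sum_subset (Finset.range_mono j.2) fun k _ hk => by
      rw [ha j k (by simpa using hk), zero_mul]
  have := Measure.isProbabilityMeasure_map (μ := Measure.infinitePi fun _ : ℕ => gaussianReal 0 1)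
    hX.aemeasurable
  have := Measure.isProbabilityMeasure_map (μ := (Measure.infinitePi fun _ : ℕ =>
    gaussianReal 0 1).map X) hf.aemeasurable
  have : IsProbabilityMeasure (normal (firstTimes t n)) := by unfold normal; infer_instance
  refine Measure.ext_of_charFun (funext fun u => ?_)
  rw [normal, charFun_multivariateGaussian (posSemidef_minCov _), Measure.map_map hf hX]
  let c : ℕ → ℝ := fun k => ∑ j : Fin n, u j * a j k
  have hsum : ∀ z, ⟪firstCoords n (X z), u⟫ = ∑ k ∈ Finset.range n, c k * z k := fun z => by
    simp only [firstCoords, PiLp.inner_apply, hXn, c, Finset.sum_mul]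
    rw [Finset.sum_comm]
    simp [Finset.mul_sum, mul_assoc]
  have hvar : ∑ k ∈ Finset.range n, c k ^ 2 = u ⬝ᵥ (minCov (firstTimes t n)).mulVec u := by
    simp only [dotProduct, Matrix.mulVec, minCov, Matrix.of_apply, firstTimes, c, sq,
      Finset.sum_mul_sum]
    simp only [Finset.mul_sum]
    rw [Finset.sum_comm]
    refine Finset.sum_congr rfl fun i _ => ?_
    rw [Finset.sum_comm]
    refine Finset.sum_congr rfl fun j _ => ?_
    rw [← h n i j i.2 j.2, Finset.sum_mul, Finset.mul_sum]
    exact Finset.sum_congr rfl fun k _ => by ring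
  have hm : Measurable fun z : ℕ → ℝ => ∑ k ∈ Finset.range n, c k * z k :=
    Finset.measurable_fun_sum _ fun k _ => measurable_const_mul_eval (c k) k
  have hc := charFun_map_sum_mul_infinitePi_gaussianReal c (Finset.range n)
  rw [charFun_apply_real, integral_map hm.aemeasurable (by fun_prop)] at hc
  rw [charFun_apply, integral_map (hf.comp hX).aemeasurable (by fun_prop)]
  simp only [Function.comp_apply, hsum]
  simpa [hvar, neg_div] using hc

/-- The values of a path along a sequence of times. -/
def sample (t : ℕ → I) (x : C₀) (n : ℕ) : ℝ := x.1 (t n)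

theorem continuous_sample (t : ℕ → I) : Continuous (sample t) := by
  unfold sample
  fun_prop

theorem injective_sample {t : ℕ → I} (ht : DenseRange t) : Function.Injective (sample t) :=
  fun x y h => Subtype.ext <| ContinuousMap.ext <| congrFun <|
    ht.equalizer x.1.continuous y.1.continuous h

/-- A sequence whose initial segments are all sampled from a compact set of paths is itself
sampled from a path in that set. -/
theorem iInter_preimage_image_proj (t : ℕ → I) {K : Set C₀} (hK : IsCompact K) :
    ⋂ n, firstCoords n ⁻¹' (proj (firstTimes t n) '' K) = sample t '' K := by
  ext y
  simp only [mem_iInter, mem_preimage]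
  constructor
  · intro hy
    -- Cantor's intersection theorem: these sets of paths are nested, compact and nonempty.
    have hne : (⋂ n, K ∩ {x | ∀ j < n, sample t x j = y j}).Nonempty := by
      have hcl : ∀ n, IsClosed {x | ∀ j < n, sample t x j = y j} := fun n => by
        simp only [ofPred_forall]
        exact isClosed_biInter fun j _ =>
          isClosed_eq ((continuous_apply j).comp (continuous_sample t)) continuous_const
      refine IsCompact.nonempty_iInter_of_sequence_nonempty_isCompact_isClosed _
        (fun n => inter_subset_inter_right _ fun x hx j hj => hx j (hj.trans n.lt_succ_self))
        (fun n => ?_) (hK.inter_right (hcl 0)) fun n => hK.isClosed.inter (hcl n)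
      obtain ⟨x, hx, hxy⟩ := hy n
      exact ⟨x, hx, fun j hj => congrArg (fun v : EuclideanSpace ℝ (Fin n) => v ⟨j, hj⟩) hxy⟩
    obtain ⟨x, hx⟩ := hne
    rw [mem_iInter] at hx
    exact ⟨x, (hx 0).1, funext fun n => (hx (n + 1)).2 n n.lt_succ_self⟩
  · rintro ⟨x, hx, rfl⟩ n
    exact ⟨x, hx, rfl⟩

theorem phi_eq_measure_image {t : ℕ → I} {P : Measure (ℕ → ℝ)} [IsProbabilityMeasure P]
    (hP : ∀ n, P.map (firstCoords n) = normal (firstTimes t n)) {K : Set C₀} (hK : IsCompact K) :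
    phi t K = P (sample t '' K) := by
  have hm : ∀ n, MeasurableSet (proj (firstTimes t n) '' K) := fun n =>
    (hK.image (continuous_proj _)).measurableSet
  refine tendsto_nhds_unique (tendsto_phi t hK) ?_
  rw [← iInter_preimage_image_proj t hK]
  have heq : approx t K = fun n => P (firstCoords n ⁻¹' (proj (firstTimes t n) '' K)) :=
    funext fun n => by
      rw [approx_eq t hK, ← hP n,
        Measure.map_apply (continuous_firstCoords n).measurable (hm n)]
  rw [heq]
  refine tendsto_measure_iInter_atTop
    (fun n => ((continuous_firstCoords n).measurable (hm n)).nullMeasurableSet) ?_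
    ⟨0, measure_ne_top _ _⟩
  rintro m n hmn y ⟨x, hx, hxy⟩
  refine ⟨x, hx, ?_⟩
  ext j
  exact congrArg (fun v : EuclideanSpace ℝ (Fin n) => v (Fin.castLE hmn j)) hxy

instance : PolishSpace C₀ :=
  (isClosed_eq (continuous_eval_const (0 : I)) continuous_const :
    IsClosed {x : C(I, ℝ) | x 0 = 0}).polishSpace

/-- On Borel sets, `mu` is a finite measure. -/
theorem exists_measure_eq_mu {t : ℕ → I} (ht : DenseRange t) :
    ∃ Q : @Measure C₀ (borel C₀), ∀ A, MeasurableSet[borel C₀] A → mu t A = Q A := by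
  let : MeasurableSpace C₀ := borel C₀
  have : BorelSpace C₀ := ⟨rfl⟩
  obtain ⟨P, _, hP⟩ := exists_sequence_law t
  -- Lusin–Souslin: a continuous injection from a Polish space sends Borel sets to Borel sets.
  have hemb : MeasurableEmbedding (sample t) :=
    (continuous_sample t).measurableEmbedding (injective_sample ht)
  have : IsFiniteMeasure (P.comap (sample t)) :=
    ⟨by rw [hemb.comap_apply]; exact measure_lt_top _ _⟩
  refine ⟨P.comap (sample t), fun A hA => ?_⟩
  -- Finite Borel measures on a Polish space are inner regular for compact sets, so both sides are
  -- suprema over the same `K`.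
  rw [hA.measure_eq_iSup_isCompact]
  refine iSup_congr fun K => iSup_congr fun _ => iSup_congr fun hK => ?_
  rw [phi_eq_measure_image hP hK, hemb.comap_apply]

theorem monotone_mu (t : ℕ → I) : Monotone (mu t) := fun _ _ h =>
  iSup_mono fun _ => iSup_mono' fun hK => ⟨hK.trans h, le_rfl⟩

/-- Continuity from below on Borel sets. -/
theorem tendsto_mu_iUnion {t : ℕ → I} (ht : DenseRange t) {A : ℕ → Set C₀}
    (hA : ∀ n, MeasurableSet[borel C₀] (A n)) (hmono : Monotone A) :
    Tendsto (fun n => mu t (A n)) atTop (𝓝 (mu t (⋃ n, A n))) := by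
  obtain ⟨Q, hQ⟩ := exists_measure_eq_mu ht
  simp only [fun n => hQ _ (hA n), hQ _ (MeasurableSet.iUnion hA)]
  exact tendsto_measure_iUnion_atTop hmono

end Wiener

theorem theorem4 (t : ℕ → unitInterval) (ht : DenseRange t) :
    (∀ (A : ℕ → Set Wiener.C₀) (K : Set Wiener.C₀),
      (∀ n, MeasurableSet[borel Wiener.C₀] (A n)) → IsCompact K →
      Monotone A → (⋃ n, A n) = K →
      Monotone (fun n => Wiener.mu t (A n)) ∧
        Tendsto (fun n => Wiener.mu t (A n)) atTop (𝓝 (Wiener.mu t K))) ∧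
    (∀ (A : ℕ → Set Wiener.C₀) (B : Set Wiener.C₀),
      (∀ n, MeasurableSet[borel Wiener.C₀] (A n)) → MeasurableSet[borel Wiener.C₀] B →
      Monotone A → (⋃ n, A n) = B →
      Monotone (fun n => Wiener.mu t (A n)) ∧
        Tendsto (fun n => Wiener.mu t (A n)) atTop (𝓝 (Wiener.mu t B))) := by
  constructor
  · rintro A _ hA - hmono rfl
    exact ⟨(Wiener.monotone_mu t).comp hmono, Wiener.tendsto_mu_iUnion ht hA hmono⟩
  · rintro A _ hA - hmono rfl
    exact ⟨(Wiener.monotone_mu t).comp hmono, Wiener.tendsto_mu_iUnion ht hA hmono⟩
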